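/- **Theorem.** Let $n\ge 1$ agents and $m$ indivisible goods (one copy each) be given, with additive utilities $u_{ij}\ge 0$ (no caps). Assume that every good $j$ has $u_{ij}>0$ for some agent $i$, and that some integral allocation of the goods has positive Nash social welfare. *CG-bound.* A solution of the spending-restricted Fisher market consists of fractions $x_{ij}\ge 0$ and prices $p_j>0$ such that, with $\alpha_i(p)=\max_\ell u_{i\ell}/p_\ell$: (1) $\sum_j x_{ij}p_j=1$ for every agent $i$; (2) $x_{ij}>0$ implies $u_{ij}/p_j=\alpha_i(p)$; (3) $\sum_i x_{ij}=1$ for every good with $p_j<1$; (4) $\sum_i x_{ij}p_j=1$ for every good with $p_j\ge 1$. Its CG-bound is $$\mathrm{CG}(p)=\Bigl(\prod_{j:\,p_j\ge 1}p_j\cdot\prod_i\alpha_i(p)\Bigr)^{1/n}.$$ *BMV-bound.* For $\alpha\in\mathbb R_{>0}^n$ let $u_j=\max_i u_{ij}/\alpha_i$. For a set $S$ of more than $m-n$ goods, with complement $\overline S$, let $a(S)=\sum_{j\in S}u_j/(n-|\overline S|)$, and let $\mathcal S_\alpha$ be the family of sets $S$ with $|S|>m-n$ and $u_j>a(S)$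 for all $j\notin S$. Put $$\mathrm{BMV}=\min_{\alpha>0}\ \min_{S\in\mathcal S_\alpha}\Bigl(\prod_{j\notin S}u_j\cdot a(S)^{\,n-|\overline S|}\cdot\prod_i\alpha_i\Bigr)^{1/n}.$$ Then a solution of the spending-restricted Fisher market exists, the minimum defining $\mathrm{BMV}$ is attained, and $\mathrm{CG}(p)=\mathrm{BMV}$ for every solution $(x,p)$ of the market. In other words, the CG-bound and the BMV-bound have the same value. -/

import Mathlib

open scoped BigOperators

noncomputable section

namespace NashWelfare

/-- Nash social welfare of the integral allocation that gives good `j` to agent `A j`: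
the geometric mean of the additive utilities of the agents. -/
def nashSocialWelfare {n m : ℕ} (u : Fin n → Fin m → ℝ) (A : Fin m → Fin n) : ℝ :=
  (∏ i, ∑ j ∈ Finset.univ.filter (fun j => A j = i), u i j) ^ (1 / (n : ℝ))

/-- Maximum bang-per-buck ratio `max_ℓ u i ℓ / p ℓ` of agent `i` at prices `p`. -/
def bangPerBuck {n m : ℕ} (u : Fin n → Fin m → ℝ) (p : Fin m → ℝ) (i : Fin n) : ℝ :=
  ⨆ l, u i l / p l

/-- `(x, p)` is a solution of the spending-restricted Fisher market with utilities `u`, where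
every agent has one unit of money, every good has one unit of supply, and `x i j` is the
fraction of good `j` that is allocated to agent `i`. -/
structure IsSpendingRestrictedSolution {n m : ℕ} (u : Fin n → Fin m → ℝ)
    (x : Fin n → Fin m → ℝ) (p : Fin m → ℝ) : Prop where
  alloc_nonneg : ∀ i j, 0 ≤ x i j
  price_pos : ∀ j, 0 < p j
  spends_all : ∀ i, ∑ j, x i j * p j = 1
  max_bang_per_buck : ∀ i j, 0 < x i j → u i j / p j = bangPerBuck u p i
  small_sold : ∀ j, p j < 1 → ∑ i, x i j = 1
  large_spending : ∀ j, 1 ≤ p j → ∑ i, x i j * p j = 1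

/-- The value of the Cole–Gkatzelis bound at prices `p`: the `n`-th root of the product of the
prices of the large goods and of the bang-per-buck ratios of all agents. -/
def cgBound {n m : ℕ} (u : Fin n → Fin m → ℝ) (p : Fin m → ℝ) : ℝ :=
  ((∏ j ∈ Finset.univ.filter (fun j => 1 ≤ p j), p j) * ∏ i, bangPerBuck u p i) ^ (1 / (n : ℝ))

/-- Uniform utility `max_i u i j / α i` of good `j` under the scaling vector `α`. -/
def uniformUtility {n m : ℕ} (u : Fin n → Fin m → ℝ) (α : Fin n → ℝ) (j : Fin m) : ℝ :=
  ⨆ i, u i j / α i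

/-- `a(S) = (∑_{j ∈ S} u_j) / (|S| - (m - n))`. -/
def average {n m : ℕ} (u : Fin n → Fin m → ℝ) (α : Fin n → ℝ) (S : Finset (Fin m)) : ℝ :=
  (∑ j ∈ S, uniformUtility u α j) / ((S.card : ℝ) - ((m : ℝ) - (n : ℝ)))

/-- The family of sets `S` of goods with `|S| > m - n` and `u_j > a(S)` for all `j ∉ S`. -/
def admissibleSets {n m : ℕ} (u : Fin n → Fin m → ℝ) (α : Fin n → ℝ) :
    Set (Finset (Fin m)) :=
  {S | (m : ℤ) - (n : ℤ) < (S.card : ℤ) ∧ ∀ j, j ∉ S → average u α S < uniformUtility u α j}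

/-- `(∏_{j ∉ S} u_j · a(S)^(n - |Sᶜ|) · ∏_i α_i)^(1/n)`. For admissible `S` one has
`|Sᶜ| < n`, so the subtraction in the exponent does not truncate. -/
def bmvObjective {n m : ℕ} (u : Fin n → Fin m → ℝ) (α : Fin n → ℝ) (S : Finset (Fin m)) : ℝ :=
  ((∏ j ∈ Sᶜ, uniformUtility u α j) * average u α S ^ (n - Sᶜ.card) * ∏ i, α i) ^ (1 / (n : ℝ))

/-- All values over which the Barman–Murthy–Vaish bound minimizes. -/
def bmvValues {n m : ℕ} (u : Fin n → Fin m → ℝ) : Set ℝ :=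
  {v | ∃ α : Fin n → ℝ, (∀ i, 0 < α i) ∧ ∃ S ∈ admissibleSets u α, v = bmvObjective u α S}

/-- The Barman–Murthy–Vaish bound. -/
def bmvBound {n m : ℕ} (u : Fin n → Fin m → ℝ) : ℝ := sInf (bmvValues u)

end NashWelfare

end

namespace NashWelfare

/-! Existence comes from a concave program over spendings `b` with column sums `q ≤ 1`. It has a
maximizer by compactness, its columns are positive because the slope of `-q log q` is infinite at
`0`, and Farkas gives multipliers `β`, `γ`. The prices `q_j * exp γ_j` clear the market, with `exp
β_i` as bang-per-buck.

For the equality, each solution's CG value is shown to be the least BMV value, so uniqueness of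
prices is not needed. The function equal to `v` below `1` and to `log v + 1` above is convex in `log
v`, with slope `min v 1`, which at a price is the spending on the good. Its tangent inequality at
`p`, applied to `v_j = u_j / a(S)` and summed over goods, is the logarithm of
`cgBound_le_bmvObjective`. Conversely, taking `α` proportional to bang-per-buck turns uniform
utilities into rescaled prices, and a price threshold set `S` attains the CG value
(`cgBound_mem_bmvValues`). -/

/-! ### Farkas' lemma -/

/-- **Farkas' lemma**: a linear functional that is nonnegative wherever finitely many linear
functionals are nonnegative is a nonnegative combination of them. -/
theorem exists_nonneg_combination_of_nonneg {V ι : Type*} [AddCommGroup V] [Module ℝ V]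
    (s : Finset ι) (a : ι → V →ₗ[ℝ] ℝ) (b : V →ₗ[ℝ] ℝ)
    (h : ∀ x, (∀ k ∈ s, 0 ≤ a k x) → 0 ≤ b x) :
    ∃ c : ι → ℝ, (∀ k, 0 ≤ c k) ∧ b = ∑ k ∈ s, c k • a k := by
  classical
  induction s using Finset.induction_on generalizing a b with
  | empty =>
    refine ⟨0, fun _ => le_rfl, ?_⟩
    ext x
    have h1 := h x (by simp)
    have h2 := h (-x) (by simp)
    simp only [map_neg] at h2
    simp only [Finset.sum_empty, LinearMap.zero_apply]
    linarith
  | insert k₀ s hk ih =>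
    by_cases hs : ∀ x, (∀ k ∈ s, 0 ≤ a k x) → 0 ≤ b x
    · obtain ⟨c, hc, hb⟩ := ih a b hs
      refine ⟨Function.update c k₀ 0, fun k => ?_, ?_⟩
      · by_cases hkk : k = k₀
        · subst hkk; simp
        · simpa [Function.update_of_ne hkk] using hc k
      · rw [Finset.sum_insert hk, hb]
        simp only [Function.update_self, zero_smul, zero_add]
        refine Finset.sum_congr rfl fun k hks => ?_
        rw [Function.update_of_ne (by rintro rfl; exact hk hks)]
    · push Not at hs
      obtain ⟨x, hx, hbx⟩ := hs
      have hax : a k₀ x < 0 := by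
        by_contra! hax
        refine absurd (h x ?_) (not_le.mpr hbx)
        simpa using ⟨hax, hx⟩
      -- project along `y` onto the kernel of `a k₀`
      set y := (-(a k₀ x))⁻¹ • x with hy
      have hpos : 0 < (-(a k₀ x))⁻¹ := inv_pos.mpr (by linarith)
      have hy0 : a k₀ y = -1 := by
        rw [hy, map_smul, smul_eq_mul, inv_neg, neg_mul, inv_mul_cancel₀ hax.ne]
      have hys : ∀ k ∈ s, 0 ≤ a k y := fun k hks => by
        rw [hy, map_smul]; exact mul_nonneg hpos.le (hx k hks)
      have hby : b y < 0 := by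
        rw [hy, map_smul]; exact mul_neg_of_pos_of_neg hpos hbx
      -- These are the functionals composed with the projection `z ↦ z + a k₀ z • y`. Expanding the
      -- result gives `a k₀` the coefficient `∑ c k * a k y - b y`, nonnegative since `b y < 0`.
      obtain ⟨c, hc, hb⟩ := ih (fun k => a k + a k y • a k₀) (b + b y • a k₀) (by
        intro z hz
        have := h (z + a k₀ z • y) (by
          intro k hk'
          rcases Finset.mem_insert.mp hk' with rfl | hk'
          · simp [hy0]
          · have := hz k hk'
            simp only [LinearMap.add_apply, LinearMap.smul_apply, smul_eq_mul] at this
            simp only [map_add, map_smul, smul_eq_mul]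
            linarith)
        simp only [map_add, map_smul, smul_eq_mul] at this
        simp only [LinearMap.add_apply, LinearMap.smul_apply, smul_eq_mul]
        linarith)
      refine ⟨Function.update c k₀ (∑ k ∈ s, c k * a k y - b y), fun k => ?_, ?_⟩
      · by_cases hkk : k = k₀
        · subst hkk
          have : 0 ≤ ∑ k ∈ s, c k * a k y :=
            Finset.sum_nonneg fun k hks => mul_nonneg (hc k) (hys k hks)
          simp only [Function.update_self]
          linarith
        · simpa [Function.update_of_ne hkk] using hc k
      · have e : ∑ k ∈ s, Function.update c k₀ (∑ k ∈ s, c k * a k y - b y) k • a k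
            = ∑ k ∈ s, c k • a k :=
          Finset.sum_congr rfl fun k hks => by
            rw [Function.update_of_ne (by rintro rfl; exact hk hks)]
        rw [Finset.sum_insert hk, e, Function.update_self]
        ext z
        have hz := LinearMap.congr_fun hb z
        simp only [LinearMap.add_apply, LinearMap.smul_apply, smul_eq_mul, LinearMap.sum_apply,
          mul_add, Finset.sum_add_distrib, ← mul_assoc, ← Finset.sum_mul, sub_mul] at hz ⊢
        linarith

/-! ### The convex program and its maximizer -/

theorem exists_injective_pos_utility {n m : ℕ} (hn : 0 < n) {u : Fin n → Fin m → ℝ}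
    (hu : ∀ i j, 0 ≤ u i j) {A : Fin m → Fin n} (hA : 0 < nashSocialWelfare u A) :
    ∃ g : Fin n → Fin m, Function.Injective g ∧ ∀ i, 0 < u i (g i) := by
  have key : ∀ i, ∃ j, A j = i ∧ 0 < u i j := by
    intro i
    by_contra! hcon
    have h0 : ∑ j ∈ Finset.univ.filter (fun j => A j = i), u i j = 0 :=
      Finset.sum_eq_zero fun j hj =>
        le_antisymm (hcon j (Finset.mem_filter.mp hj).2) (hu i j)
    rw [nashSocialWelfare, Finset.prod_eq_zero (Finset.mem_univ i) h0,
      Real.zero_rpow (by positivity)] at hA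
    exact lt_irrefl _ hA
  choose g hg hgu using key
  exact ⟨g, fun i i' h => by rw [← hg i, ← hg i', h], hgu⟩

/-- The objective of the convex program whose optimal spendings `b` are those of the
spending-restricted market. -/
noncomputable def spendingObjective {n m : ℕ} (u : Fin n → Fin m → ℝ) (b : Fin n → Fin m → ℝ) : ℝ :=
  ∑ i, ∑ j, b i j * Real.log (u i j) + ∑ j, (Real.negMulLog (∑ i, b i j) + ∑ i, b i j)

/-- Feasible spendings: agents spend one unit of money on goods they value, and no good
receives more than one unit of money. -/
def feasibleSpendings {n m : ℕ} (u : Fin n → Fin m → ℝ) : Set (Fin n → Fin m → ℝ) :=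
  {b | (∀ i j, 0 ≤ b i j) ∧ (∀ i j, u i j ≤ 0 → b i j = 0) ∧ (∀ i, ∑ j, b i j = 1) ∧
    ∀ j, ∑ i, b i j ≤ 1}

theorem isCompact_feasibleSpendings {n m : ℕ} (u : Fin n → Fin m → ℝ) :
    IsCompact (feasibleSpendings u) := by
  refine IsCompact.of_isClosed_subset (isCompact_Icc (a := 0) (b := 1)) ?_ ?_
  · simp only [feasibleSpendings, Set.ofPred_and, Set.ofPred_forall]
    refine IsClosed.inter ?_ (IsClosed.inter ?_ (IsClosed.inter ?_ ?_))
    · exact isClosed_iInter fun i => isClosed_iInter fun j =>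
        isClosed_le (by fun_prop) (by fun_prop)
    · exact isClosed_iInter fun i => isClosed_iInter fun j => isClosed_iInter fun _ =>
        isClosed_eq (by fun_prop) (by fun_prop)
    · exact isClosed_iInter fun i => isClosed_eq (by fun_prop) (by fun_prop)
    · exact isClosed_iInter fun i => isClosed_le (by fun_prop) (by fun_prop)
  · rintro b ⟨h0, -, -, h1⟩
    exact ⟨fun i j => h0 i j, fun i j =>
      (Finset.single_le_sum (f := fun i => b i j) (fun i _ => h0 i j)
        (Finset.mem_univ i)).trans (h1 j)⟩

/-- The matching `g` yields a feasible point: each agent puts all its money on its own good. -/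
theorem exists_isMaxOn_spendingObjective {n m : ℕ} {u : Fin n → Fin m → ℝ}
    {g : Fin n → Fin m} (hg : Function.Injective g) (hgu : ∀ i, 0 < u i (g i)) :
    ∃ b ∈ feasibleSpendings u, IsMaxOn (spendingObjective u) (feasibleSpendings u) b := by
  classical
  refine (isCompact_feasibleSpendings u).exists_isMaxOn
    ⟨fun i j => if j = g i then 1 else 0, ?_, ?_, ?_, ?_⟩ ?_
  · intro i j; dsimp only; split_ifs <;> norm_num
  · intro i j hij
    exact if_neg (by rintro rfl; exact absurd (hgu i) (not_lt.mpr hij))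
  · intro i; simp
  · intro j
    rw [Finset.sum_boole]
    have : (Finset.univ.filter fun i => j = g i).card ≤ 1 :=
      Finset.card_le_one.mpr fun i hi i' hi' =>
        hg ((Finset.mem_filter.mp hi).2.symm.trans (Finset.mem_filter.mp hi').2)
    exact_mod_cast this
  · refine Continuous.continuousOn ?_
    unfold spendingObjective
    have := Real.continuous_negMulLog
    fun_prop

/-! ### First-order optimality conditions -/

theorem mul_log_div_le {a b : ℝ} (ha : 0 < a) (hb : 0 ≤ b) :
    b * (Real.log a - Real.log b) ≤ a - b := by
  rcases hb.eq_or_lt with rfl | hb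
  · simpa using ha.le
  · rw [← Real.log_div ha.ne' hb.ne']
    have := mul_le_mul_of_nonneg_left (Real.log_le_sub_one_of_pos (div_pos ha hb)) hb.le
    rwa [mul_sub, mul_div_cancel₀ _ hb.ne', mul_one] at this

/-- First-order condition: along a feasible direction `d` with column sums `D`, the marginal gain
is at most the marginal loss at the perturbed point. -/
theorem sum_mul_log_le_of_isMaxOn {n m : ℕ} {u : Fin n → Fin m → ℝ} {b d : Fin n → Fin m → ℝ}
    (hmax : IsMaxOn (spendingObjective u) (feasibleSpendings u) b) (hb : b ∈ feasibleSpendings u)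
    {t : ℝ} (ht : 0 < t) (hd : (fun i j => b i j + t * d i j) ∈ feasibleSpendings u)
    (hD : ∀ j, 0 < ∑ i, b i j + t * ∑ i, d i j ∨ ∑ i, d i j = 0) :
    ∑ i, ∑ j, d i j * Real.log (u i j) ≤
      ∑ j, (∑ i, d i j) * Real.log (∑ i, b i j + t * ∑ i, d i j) := by
  have h := hmax hd
  simp only [Set.mem_ofPred_eq, spendingObjective, Finset.sum_add_distrib, ← Finset.mul_sum,
    add_mul, mul_assoc] at h
  -- The concave function `q - q log q` has slope `-log q`. The tangent is taken at the perturbed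
  -- point, so the original column sum may be `0`.
  have key : ∀ j, Real.negMulLog (∑ i, b i j) + ∑ i, b i j -
      (Real.negMulLog (∑ i, b i j + t * ∑ i, d i j) + (∑ i, b i j + t * ∑ i, d i j)) ≤
      t * ((∑ i, d i j) * Real.log (∑ i, b i j + t * ∑ i, d i j)) := by
    intro j
    rcases hD j with hj | hj
    · have := mul_log_div_le hj (Finset.sum_nonneg fun i (_ : i ∈ Finset.univ) => hb.1 i j)
      simp only [Real.negMulLog]
      linarith
    · simp [hj]
  have hsum := Finset.sum_le_sum fun j (_ : j ∈ Finset.univ) => key j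
  simp only [Finset.sum_sub_distrib, Finset.sum_add_distrib, ← Finset.mul_sum] at hsum
  refine le_of_mul_le_mul_left ?_ ht
  linarith

/-- Tight constraints survive by the sign of `d`, strict ones by continuity for small `t`. -/
theorem eventually_add_mul_mem_feasibleSpendings {n m : ℕ} {u b d : Fin n → Fin m → ℝ}
    (hb : b ∈ feasibleSpendings u) (hd0 : ∀ i j, b i j = 0 → 0 ≤ d i j)
    (hdu : ∀ i j, u i j ≤ 0 → d i j = 0) (hdr : ∀ i, ∑ j, d i j = 0)
    (hdc : ∀ j, ∑ i, b i j = 1 → ∑ i, d i j ≤ 0) :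
    ∀ᶠ t in nhdsWithin (0 : ℝ) (Set.Ioi 0), (fun i j => b i j + t * d i j) ∈ feasibleSpendings u := by
  obtain ⟨h0, h1, h2, h3⟩ := hb
  have e1 : ∀ i j, ∀ᶠ t in nhdsWithin (0 : ℝ) (Set.Ioi 0), 0 ≤ b i j + t * d i j := by
    intro i j
    rcases (h0 i j).eq_or_lt with h | h
    · filter_upwards [self_mem_nhdsWithin] with t ht
      rw [← h, zero_add]
      exact mul_nonneg (le_of_lt ht) (hd0 i j h.symm)
    · have : ContinuousAt (fun t : ℝ => b i j + t * d i j) 0 := by fun_prop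
      filter_upwards [nhdsWithin_le_nhds (this.eventually (lt_mem_nhds (a := 0) (by simpa using h)))]
        with t ht using ht.le
  have e2 : ∀ j, ∀ᶠ t in nhdsWithin (0 : ℝ) (Set.Ioi 0), ∑ i, b i j + t * ∑ i, d i j ≤ 1 := by
    intro j
    rcases (h3 j).eq_or_lt with h | h
    · filter_upwards [self_mem_nhdsWithin] with t ht
      have := mul_nonneg (le_of_lt ht) (neg_nonneg.mpr (hdc j h))
      linarith
    · have : ContinuousAt (fun t : ℝ => ∑ i, b i j + t * ∑ i, d i j) 0 := by fun_prop
      filter_upwards [nhdsWithin_le_nhds (this.tendsto.eventually_lt_const (u := 1) (by simpa using h))]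
        with t ht using ht.le
  filter_upwards [Filter.eventually_all.mpr fun i => Filter.eventually_all.mpr (e1 i),
    Filter.eventually_all.mpr e2] with t ht1 ht2
  refine ⟨ht1, fun i j hij => ?_, fun i => ?_, fun j => ?_⟩
  · simp [h1 i j hij, hdu i j hij]
  · rw [Finset.sum_add_distrib, ← Finset.mul_sum, h2, hdr, mul_zero, add_zero]
  · rw [Finset.sum_add_distrib, ← Finset.mul_sum]
    exact ht2 j

/-- If nobody spent on `j₀`, an agent valuing it could move `t` units of money there from `j₁`. The
marginal gain grows like `-log t`, so this improves `b` for small `t`. -/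
theorem sum_spending_pos_of_isMaxOn {n m : ℕ} {u b : Fin n → Fin m → ℝ}
    (hgood : ∀ j, ∃ i, 0 < u i j)
    (hmax : IsMaxOn (spendingObjective u) (feasibleSpendings u) b) (hb : b ∈ feasibleSpendings u)
    (j₀ : Fin m) : 0 < ∑ i, b i j₀ := by
  classical
  by_contra! hle
  have hz : ∀ i, b i j₀ = 0 := fun i =>
    (Finset.sum_eq_zero_iff_of_nonneg fun i _ => hb.1 i j₀).mp
      (le_antisymm hle (Finset.sum_nonneg fun i _ => hb.1 i j₀)) i (Finset.mem_univ i)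
  obtain ⟨i₀, hi₀⟩ := hgood j₀
  obtain ⟨j₁, hj₁⟩ : ∃ j, 0 < b i₀ j := by
    by_contra! hcon
    have := Finset.sum_nonpos fun j (_ : j ∈ Finset.univ) => hcon j
    rw [hb.2.2.1 i₀] at this
    linarith
  have hne : j₁ ≠ j₀ := by rintro rfl; exact hj₁.ne' (hz i₀)
  have hq₁ : 0 < ∑ i, b i j₁ :=
    hj₁.trans_le (Finset.single_le_sum (f := fun i => b i j₁) (fun i _ => hb.1 i j₁)
      (Finset.mem_univ i₀))
  set d : Fin n → Fin m → ℝ := fun i j =>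
    if i = i₀ then (if j = j₀ then 1 else 0) - (if j = j₁ then 1 else 0) else 0 with hd
  have hcol : ∀ j, ∑ i, d i j = (if j = j₀ then 1 else 0) - (if j = j₁ then 1 else 0) := by
    intro j; simp [hd]
  have hfeas := eventually_add_mul_mem_feasibleSpendings (d := d) hb
    (by
      intro i j hij
      simp only [hd]
      by_cases hi : i = i₀
      · subst hi
        have : j ≠ j₁ := by rintro rfl; exact hj₁.ne' hij
        rw [if_pos rfl, if_neg this]
        split_ifs <;> norm_num
      · rw [if_neg hi])
    (by
      intro i j hij
      simp only [hd]
      by_cases hi : i = i₀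
      · subst hi
        have h1 : j ≠ j₁ := by rintro rfl; exact hj₁.ne' (hb.2.1 _ _ hij)
        have h2 : j ≠ j₀ := by rintro rfl; exact absurd hi₀ (not_lt.mpr hij)
        simp [h1, h2]
      · rw [if_neg hi])
    (by intro i; by_cases hi : i = i₀ <;> simp [hd, hi])
    (by
      intro j hj
      rw [hcol]
      have : j ≠ j₀ := by rintro rfl; linarith
      rw [if_neg this]
      split_ifs <;> norm_num)
  have hlim : Filter.Tendsto (fun t => Real.log t - Real.log (∑ i, b i j₁ - t))
      (nhdsWithin (0 : ℝ) (Set.Ioi 0)) Filter.atBot := by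
    simp only [sub_eq_add_neg]
    refine Filter.Tendsto.atBot_add Real.tendsto_log_nhdsGT_zero
      (C := -Real.log (∑ i, b i j₁ + -0)) ?_
    have : ContinuousAt (fun t : ℝ => -Real.log (∑ i, b i j₁ + -t)) 0 :=
      ((by fun_prop : ContinuousAt (fun t : ℝ => ∑ i, b i j₁ + -t) 0).log
        (by simpa using hq₁.ne')).neg
    exact this.tendsto.mono_left nhdsWithin_le_nhds
  obtain ⟨t, ht, ht₀, ht₁, htlim⟩ := (hfeas.and (Filter.Eventually.and
    (self_mem_nhdsWithin : ∀ᶠ t in nhdsWithin (0 : ℝ) (Set.Ioi 0), t ∈ Set.Ioi 0)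
    (Filter.Eventually.and (nhdsWithin_le_nhds (gt_mem_nhds hq₁))
      (hlim.eventually_lt_atBot (∑ i, ∑ j, d i j * Real.log (u i j)))))).exists
  have ht₀' : 0 < t := ht₀
  have ht₁' : t < ∑ i, b i j₁ := ht₁
  have hfo := sum_mul_log_le_of_isMaxOn hmax hb ht₀' ht (by
    intro j
    rw [hcol]
    by_cases h0 : j = j₀
    · subst h0; left; simp [hz, hne.symm, ht₀']
    · by_cases h1 : j = j₁
      · subst h1; left; simp [h0, ht₁']
      · right; simp [h0, h1])
  simp only [hcol, sub_mul, ite_mul, one_mul, zero_mul, Finset.sum_sub_distrib,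
    Finset.sum_ite_eq', Finset.mem_univ, if_true, hz, Finset.sum_const_zero, zero_add,
    if_neg hne, if_neg hne.symm, sub_zero, mul_one, zero_sub, mul_neg, ← sub_eq_add_neg] at hfo
  exact absurd hfo (not_le.mpr htlim)

/-- Let `t → 0` in the first-order condition; positive column sums make the logarithms continuous.
-/
theorem sum_mul_marginal_nonpos_of_isMaxOn {n m : ℕ} {u b d : Fin n → Fin m → ℝ}
    (hmax : IsMaxOn (spendingObjective u) (feasibleSpendings u) b) (hb : b ∈ feasibleSpendings u)
    (hq : ∀ j, 0 < ∑ i, b i j) (hd0 : ∀ i j, b i j = 0 → 0 ≤ d i j)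
    (hdu : ∀ i j, u i j ≤ 0 → d i j = 0) (hdr : ∀ i, ∑ j, d i j = 0)
    (hdc : ∀ j, ∑ i, b i j = 1 → ∑ i, d i j ≤ 0) :
    ∑ i, ∑ j, d i j * (Real.log (u i j) - Real.log (∑ i, b i j)) ≤ 0 := by
  have hfeas := eventually_add_mul_mem_feasibleSpendings hb hd0 hdu hdr hdc
  have hcont : ∀ j, ContinuousAt (fun t : ℝ => ∑ i, b i j + t * ∑ i, d i j) 0 := fun j => by
    fun_prop
  have hpos : ∀ᶠ t in nhdsWithin (0 : ℝ) (Set.Ioi 0), ∀ j, 0 < ∑ i, b i j + t * ∑ i, d i j :=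
    nhdsWithin_le_nhds (Filter.eventually_all.mpr fun j =>
      (hcont j).eventually (lt_mem_nhds (a := 0) (by simpa using hq j)))
  have hlim : ContinuousAt
      (fun t : ℝ => ∑ j, (∑ i, d i j) * Real.log (∑ i, b i j + t * ∑ i, d i j)) 0 :=
    tendsto_finsetSum _ fun j _ =>
      (continuousAt_const.mul ((hcont j).log (by simpa using (hq j).ne'))).tendsto
  have hle := ge_of_tendsto (hlim.tendsto.mono_left nhdsWithin_le_nhds)
    (b := ∑ i, ∑ j, d i j * Real.log (u i j)) (by
      filter_upwards [hfeas, hpos, self_mem_nhdsWithin] with t ht htp ht0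
      exact sum_mul_log_le_of_isMaxOn hmax hb ht0 ht fun j => Or.inl (htp j))
  simp only [zero_mul, add_zero] at hle
  simp only [mul_sub, Finset.sum_sub_distrib]
  rw [Finset.sum_comm (f := fun i j => d i j * Real.log (∑ i, b i j))]
  simp only [← Finset.sum_mul]
  linarith

/-! ### Multipliers and market prices -/

/-- The linear functional on matrices with coefficients `w`. -/
def matrixFunctional {n m : ℕ} (w : Fin n → Fin m → ℝ) : (Fin n → Fin m → ℝ) →ₗ[ℝ] ℝ :=
  ∑ i, ∑ j, w i j •
    (LinearMap.proj (φ := fun _ => ℝ) j ∘ₗ LinearMap.proj (φ := fun _ => Fin m → ℝ) i)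

theorem matrixFunctional_apply {n m : ℕ} (w d : Fin n → Fin m → ℝ) :
    matrixFunctional w d = ∑ i, ∑ j, w i j * d i j := by
  simp [matrixFunctional]

theorem matrixFunctional_single {n m : ℕ} (w : Fin n → Fin m → ℝ) (i : Fin n) (j : Fin m) :
    matrixFunctional w (Pi.single i (Pi.single j 1)) = w i j := by
  rw [matrixFunctional_apply, Finset.sum_eq_single i, Finset.sum_eq_single j]
  · simp
  · intro j' _ hj'; simp [hj']
  · simp
  · intro i' _ hi'; simp [hi']
  · simp

/-- Optimal spendings have multipliers for the budget constraints of the agents and the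
spending restrictions of the goods. -/
theorem exists_multipliers_of_isMaxOn {n m : ℕ} {u b : Fin n → Fin m → ℝ}
    (hmax : IsMaxOn (spendingObjective u) (feasibleSpendings u) b) (hb : b ∈ feasibleSpendings u)
    (hq : ∀ j, 0 < ∑ i, b i j) :
    ∃ (β : Fin n → ℝ) (γ : Fin m → ℝ), (∀ j, 0 ≤ γ j) ∧ (∀ j, ∑ i, b i j ≠ 1 → γ j = 0) ∧
      (∀ i j, 0 < u i j → Real.log (u i j) - Real.log (∑ i, b i j) ≤ β i + γ j) ∧
      ∀ i j, 0 < b i j → Real.log (u i j) - Real.log (∑ i, b i j) = β i + γ j := by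
  classical
  -- The mask `e` confines directions to valued goods. The functionals `a` encode entries with `b =
  -- 0`, the row equalities as two inequalities each, and the saturated columns.
  set e : Fin n → Fin m → ℝ := fun i j => if 0 < u i j then 1 else 0 with he
  let a : (Fin n × Fin m) ⊕ (Fin n ⊕ Fin n) ⊕ Fin m → Fin n → Fin m → ℝ :=
    Sum.elim (fun k i j => if k = (i, j) then (if b i j = 0 then 1 else 0) else 0)
      (Sum.elim (Sum.elim (fun k i j => if k = i then e i j else 0)
        (fun k i j => if k = i then -e i j else 0))
        (fun k i j => if k = j then (if ∑ i, b i j = 1 then -e i j else 0) else 0))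
  obtain ⟨y, hy0, hy⟩ := exists_nonneg_combination_of_nonneg Finset.univ
    (fun k => matrixFunctional (a k))
    (matrixFunctional fun i j => -(e i j * (Real.log (u i j) - Real.log (∑ i, b i j)))) (by
      intro d hd
      have hrow1 : ∀ i, 0 ≤ ∑ j, e i j * d i j := fun i => by
        simpa [a, matrixFunctional_apply] using hd (Sum.inr (Sum.inl (Sum.inl i)))
      have hrow2 : ∀ i, ∑ j, e i j * d i j ≤ 0 := fun i => by
        simpa [a, matrixFunctional_apply] using hd (Sum.inr (Sum.inl (Sum.inr i)))
      have hmain := sum_mul_marginal_nonpos_of_isMaxOn (d := fun i j => e i j * d i j) hmax hb hq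
        (by
          intro i j hij
          have := hd (Sum.inl (i, j)) (Finset.mem_univ _)
          have hd' : 0 ≤ d i j := by
            rw [matrixFunctional_apply, Finset.sum_eq_single i, Finset.sum_eq_single j] at this
            · simpa [a, hij] using this
            · intro j' _ hj'; simp [a, hj'.symm]
            · simp
            · intro i' _ hi'; simp [a, hi'.symm]
            · simp
          simp only [he]
          split_ifs <;> simp [hd'])
        (by intro i j hij; simp [he, not_lt.mpr hij])
        (fun i => le_antisymm (hrow2 i) (hrow1 i))
        (by
          intro j hj
          have := hd (Sum.inr (Sum.inr j)) (Finset.mem_univ _)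
          simpa [a, matrixFunctional_apply, hj] using this)
      rw [matrixFunctional_apply]
      simp only [neg_mul, Finset.sum_neg_distrib]
      have hcomm : ∑ i, ∑ j, e i j * (Real.log (u i j) - Real.log (∑ i, b i j)) * d i j =
          ∑ i, ∑ j, e i j * d i j * (Real.log (u i j) - Real.log (∑ i, b i j)) :=
        Finset.sum_congr rfl fun i _ => Finset.sum_congr rfl fun j _ => mul_right_comm _ _ _
      rw [hcomm]
      linarith)
  -- Evaluating the Farkas identity at a matrix unit compares coefficients.
  have hcoef : ∀ i j, 0 < u i j → -(Real.log (u i j) - Real.log (∑ i, b i j)) =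
      y (Sum.inl (i, j)) * (if b i j = 0 then 1 else 0) + (y (Sum.inr (Sum.inl (Sum.inl i))) -
        y (Sum.inr (Sum.inl (Sum.inr i))) -
        y (Sum.inr (Sum.inr j)) * (if ∑ i, b i j = 1 then 1 else 0)) := by
    intro i j hij
    have := LinearMap.congr_fun hy (Pi.single i (Pi.single j 1))
    simp only [LinearMap.sum_apply, LinearMap.smul_apply, matrixFunctional_single,
      smul_eq_mul] at this
    simp only [Fintype.sum_sum_type, Fintype.sum_prod_type, he, if_pos hij, one_mul] at this
    rw [this]
    have hpair : ∀ i' j', ((i', j') = (i, j)) = (i' = i ∧ j' = j) := fun _ _ => by simp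
    simp only [a, he, Sum.elim_inl, Sum.elim_inr, if_pos hij, hpair, ite_and, mul_ite, mul_one,
      mul_zero, mul_neg, Finset.sum_ite_irrel, Finset.sum_const_zero, Finset.sum_ite_eq',
      Finset.mem_univ, if_true]
    split_ifs <;> ring
  refine ⟨fun i => y (Sum.inr (Sum.inl (Sum.inr i))) - y (Sum.inr (Sum.inl (Sum.inl i))),
    fun j => y (Sum.inr (Sum.inr j)) * (if ∑ i, b i j = 1 then 1 else 0), ?_, ?_, ?_, ?_⟩
  · intro j
    exact mul_nonneg (hy0 _) (by split_ifs <;> norm_num)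
  · intro j hj
    simp [hj]
  · intro i j hij
    have h1 := hcoef i j hij
    have h2 : 0 ≤ y (Sum.inl (i, j)) * (if b i j = 0 then (1 : ℝ) else 0) :=
      mul_nonneg (hy0 _) (by split_ifs <;> norm_num)
    linarith
  · intro i j hij
    have hu : 0 < u i j := by
      by_contra! hu
      exact hij.ne' (hb.2.1 i j hu)
    have h1 := hcoef i j hu
    rw [if_neg hij.ne', mul_zero] at h1
    linarith

/-- Complementary slackness separates the goods: `γ` vanishes on unsaturated columns, so there the
price equals the spending and is below `1`, while saturated columns have price at least `1`. -/
theorem exists_isSpendingRestrictedSolution {n m : ℕ} {u : Fin n → Fin m → ℝ}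
    (hu : ∀ i j, 0 ≤ u i j) (hgood : ∀ j, ∃ i, 0 < u i j)
    {g : Fin n → Fin m} (hg : Function.Injective g) (hgu : ∀ i, 0 < u i (g i)) :
    ∃ x p, IsSpendingRestrictedSolution u x p := by
  obtain ⟨b, hb, hmax⟩ := exists_isMaxOn_spendingObjective hg hgu
  have hq := sum_spending_pos_of_isMaxOn hgood hmax hb
  obtain ⟨β, γ, hγ0, hγ, hle, heq⟩ := exists_multipliers_of_isMaxOn hmax hb hq
  set p : Fin m → ℝ := fun j => (∑ i, b i j) * Real.exp (γ j) with hp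
  have hp0 : ∀ j, 0 < p j := fun j => mul_pos (hq j) (Real.exp_pos _)
  have hlog : ∀ j, Real.log (p j) = Real.log (∑ i, b i j) + γ j := fun j => by
    rw [hp, Real.log_mul (hq j).ne' (Real.exp_pos _).ne', Real.log_exp]
  have hsmall : ∀ j, ∑ i, b i j ≠ 1 → p j = ∑ i, b i j := fun j hj => by
    simp [hp, hγ j hj]
  have hratio : ∀ i j, u i j / p j ≤ Real.exp (β i) := by
    intro i j
    rcases (hu i j).eq_or_lt with h | h
    · rw [← h, zero_div]; exact (Real.exp_pos _).le
    · rw [← Real.log_le_iff_le_exp (div_pos h (hp0 j)), Real.log_div h.ne' (hp0 j).ne', hlog]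
      linarith [hle i j h]
  refine ⟨fun i j => b i j / p j, p, ?_, hp0, ?_, ?_, ?_, ?_⟩
  · exact fun i j => div_nonneg (hb.1 i j) (hp0 j).le
  · intro i
    simp only [div_mul_cancel₀ _ (hp0 _).ne']
    exact hb.2.2.1 i
  · intro i j hij
    have hbij : 0 < b i j := by
      rcases (hb.1 i j).eq_or_lt with h | h
      · simp [← h] at hij
      · exact h
    have huij : 0 < u i j := by
      by_contra! h
      exact hbij.ne' (hb.2.1 i j h)
    have : Real.exp (β i) = u i j / p j := by
      rw [← Real.exp_log (div_pos huij (hp0 j)), Real.log_div huij.ne' (hp0 j).ne', hlog]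
      congr 1
      linarith [heq i j hbij]
    have hne : Nonempty (Fin m) := ⟨j⟩
    refine le_antisymm (le_ciSup (f := fun l => u i l / p l) (Set.finite_range _).bddAbove j) ?_
    rw [← this]
    exact ciSup_le (hratio i)
  · intro j hj
    have h1 : ∑ i, b i j ≠ 1 := by
      intro h
      have := Real.one_le_exp (hγ0 j)
      simp only [hp, h, one_mul] at hj
      linarith
    rw [← Finset.sum_div, hsmall j h1, div_self (hq j).ne']
  · intro j hj
    simp only [div_mul_cancel₀ _ (hp0 _).ne']
    by_contra h1
    rw [hsmall j h1] at hj
    exact h1 (le_antisymm (hb.2.2.2 j) hj)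

/-! ### Uniform utilities and total spending -/

theorem le_uniformUtility {n m : ℕ} (u : Fin n → Fin m → ℝ) (α : Fin n → ℝ) (i : Fin n)
    (j : Fin m) : u i j / α i ≤ uniformUtility u α j :=
  le_ciSup (f := fun i => u i j / α i) (Set.finite_range _).bddAbove i

theorem le_bangPerBuck {n m : ℕ} (u : Fin n → Fin m → ℝ) (p : Fin m → ℝ) (i : Fin n)
    (j : Fin m) : u i j / p j ≤ bangPerBuck u p i :=
  le_ciSup (f := fun j => u i j / p j) (Set.finite_range _).bddAbove j

theorem uniformUtility_pos {n m : ℕ} {u : Fin n → Fin m → ℝ} (hgood : ∀ j, ∃ i, 0 < u i j)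
    {α : Fin n → ℝ} (hα : ∀ i, 0 < α i) (j : Fin m) : 0 < uniformUtility u α j := by
  obtain ⟨i, hi⟩ := hgood j
  exact (div_pos hi (hα i)).trans_le (le_uniformUtility u α i j)

theorem cast_sub_card_compl {n m : ℕ} (S : Finset (Fin m)) :
    ((S.card : ℝ) - ((m : ℝ) - (n : ℝ))) = (n : ℝ) - (Sᶜ.card : ℝ) := by
  have h := S.card_add_card_compl
  rw [Fintype.card_fin] at h
  have h' : (S.card : ℝ) + (Sᶜ.card : ℝ) = m := by exact_mod_cast h
  linarith

namespace IsSpendingRestrictedSolution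

variable {n m : ℕ} {u x : Fin n → Fin m → ℝ} {p : Fin m → ℝ}

theorem sum_spending (h : IsSpendingRestrictedSolution u x p) (j : Fin m) :
    ∑ i, x i j * p j = min (p j) 1 := by
  rcases lt_or_ge (p j) 1 with hj | hj
  · rw [← Finset.sum_mul, h.small_sold j hj, one_mul, min_eq_left hj.le]
  · rw [h.large_spending j hj, min_eq_right hj]

theorem sum_min_price (h : IsSpendingRestrictedSolution u x p) : ∑ j, min (p j) 1 = n := by
  simp_rw [← h.sum_spending]
  rw [Finset.sum_comm]
  simp [h.spends_all]

theorem exists_pos_alloc (h : IsSpendingRestrictedSolution u x p) (j : Fin m) :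
    ∃ i, 0 < x i j := by
  by_contra! hcon
  have h0 : ∑ i, x i j * p j ≤ 0 :=
    Finset.sum_nonpos fun i _ => mul_nonpos_of_nonpos_of_nonneg (hcon i) (h.price_pos j).le
  rw [h.sum_spending] at h0
  exact absurd h0 (not_le.mpr (lt_min (h.price_pos j) one_pos))

theorem bangPerBuck_pos (h : IsSpendingRestrictedSolution u x p) {g : Fin n → Fin m}
    (hgu : ∀ i, 0 < u i (g i)) (i : Fin n) : 0 < bangPerBuck u p i :=
  (div_pos (hgu i) (h.price_pos _)).trans_le (le_bangPerBuck u p i _)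

end IsSpendingRestrictedSolution

/-! ### CG is a lower bound -/

/-- Tangent inequality, in logarithmic coordinates, for the convex function that is `v` for
`v ≤ 1` and `log v + 1` for `1 ≤ v`. -/
theorem min_one_mul_log_sub_log_le {p v : ℝ} (hp : 0 < p) (hv : 0 < v) (P : Prop) [Decidable P]
    (hP : ¬P → 1 ≤ v) :
    min p 1 * (Real.log v - Real.log p) ≤
      (if P then v else Real.log v + 1) - ((if 1 ≤ p then Real.log p else 0) + min p 1) := by
  rcases lt_or_ge p 1 with hp1 | hp1
  · rw [min_eq_left hp1.le, if_neg (not_le.mpr hp1)]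
    split_ifs with h
    · linarith [mul_log_div_le hv hp.le]
    · have h1 := mul_log_div_le one_pos hp.le
      have h2 := mul_nonneg (sub_nonneg.mpr hp1.le) (Real.log_nonneg (hP h))
      rw [Real.log_one] at h1
      linarith
  · rw [min_eq_right hp1, if_pos hp1]
    split_ifs with h
    · linarith [Real.log_le_sub_one_of_pos hv]
    · linarith

theorem card_compl_lt_of_mem_admissibleSets {n m : ℕ} {u : Fin n → Fin m → ℝ} {α : Fin n → ℝ}
    {S : Finset (Fin m)} (hS : S ∈ admissibleSets u α) : Sᶜ.card < n := by
  have h := S.card_add_card_compl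
  rw [Fintype.card_fin] at h
  have := hS.1
  omega

theorem average_pos {n m : ℕ} {u : Fin n → Fin m → ℝ} (hnm : n ≤ m)
    (hgood : ∀ j, ∃ i, 0 < u i j) {α : Fin n → ℝ} (hα : ∀ i, 0 < α i) {S : Finset (Fin m)}
    (hS : S ∈ admissibleSets u α) : 0 < average u α S := by
  have hlt : (Sᶜ.card : ℝ) < n := by exact_mod_cast card_compl_lt_of_mem_admissibleSets hS
  have hne : S.Nonempty := by
    rw [← Finset.card_pos]
    have := hS.1
    omega
  refine div_pos (Finset.sum_pos (fun j _ => uniformUtility_pos hgood hα j) hne) ?_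
  rw [cast_sub_card_compl]
  linarith

theorem IsSpendingRestrictedSolution.cgBound_le_bmvObjective {n m : ℕ}
    {u x : Fin n → Fin m → ℝ} {p : Fin m → ℝ} (h : IsSpendingRestrictedSolution u x p)
    (hnm : n ≤ m) (hgood : ∀ j, ∃ i, 0 < u i j) {g : Fin n → Fin m} (hgu : ∀ i, 0 < u i (g i))
    {α : Fin n → ℝ} (hα : ∀ i, 0 < α i) {S : Finset (Fin m)} (hS : S ∈ admissibleSets u α) :
    cgBound u p ≤ bmvObjective u α S := by
  classical
  have hU := uniformUtility_pos hgood hα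
  have ha := average_pos hnm hgood hα hS
  have hB := h.bangPerBuck_pos hgu
  have hK := card_compl_lt_of_mem_admissibleSets hS
  set a := average u α S with ha_def
  set U := uniformUtility u α with hU_def
  have hlogv : ∀ j, Real.log (U j / a) = Real.log (U j) - Real.log a := fun j =>
    Real.log_div (hU j).ne' ha.ne'
  have htangent := Finset.sum_le_sum fun j (_ : j ∈ Finset.univ) =>
    min_one_mul_log_sub_log_le (h.price_pos j) (div_pos (hU j) ha) (j ∈ S)
      (fun hj => (one_le_div ha).mpr (hS.2 j hj).le)
  have hlower : ∑ i, (Real.log (bangPerBuck u p i) - Real.log (α i) - Real.log a) ≤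
      ∑ j, min (p j) 1 * (Real.log (U j / a) - Real.log (p j)) := by
    calc ∑ i, (Real.log (bangPerBuck u p i) - Real.log (α i) - Real.log a)
        = ∑ i, ∑ j, x i j * p j *
            (Real.log (bangPerBuck u p i) - Real.log (α i) - Real.log a) := by
          simp_rw [← Finset.sum_mul, h.spends_all, one_mul]
      _ ≤ ∑ i, ∑ j, x i j * p j * (Real.log (U j / a) - Real.log (p j)) := by
          refine Finset.sum_le_sum fun i _ => Finset.sum_le_sum fun j _ => ?_
          -- Where money is spent, `u i j` is bang-per-buck times price, and `u i j / α i ≤ U j`.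
          rcases (h.alloc_nonneg i j).eq_or_lt with hx | hx
          · simp [← hx]
          · refine mul_le_mul_of_nonneg_left ?_ (mul_pos hx (h.price_pos j)).le
            have huij : u i j = bangPerBuck u p i * p j := by
              rw [← h.max_bang_per_buck i j hx, div_mul_cancel₀ _ (h.price_pos j).ne']
            have hup : 0 < u i j := huij ▸ mul_pos (hB i) (h.price_pos j)
            have hle := Real.log_le_log (div_pos hup (hα i)) (le_uniformUtility u α i j)
            rw [Real.log_div hup.ne' (hα i).ne', huij,
              Real.log_mul (hB i).ne' (h.price_pos j).ne'] at hle
            rw [hlogv]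
            linarith
      _ = ∑ j, min (p j) 1 * (Real.log (U j / a) - Real.log (p j)) := by
          rw [Finset.sum_comm]
          exact Finset.sum_congr rfl fun j _ => by rw [← Finset.sum_mul, h.sum_spending]
  -- The denominator of `a(S)` makes the constants in `hsplit` add up to `n`, cancelling the total
  -- spending.
  have hSsum : ∑ j ∈ S, U j / a = n - Sᶜ.card := by
    rw [← Finset.sum_div, div_eq_iff ha.ne', ha_def, average, cast_sub_card_compl, mul_div_cancel₀]
    have : (Sᶜ.card : ℝ) < n := by exact_mod_cast hK
    linarith
  have hsplit : ∑ j, (if j ∈ S then U j / a else Real.log (U j / a) + 1) =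
      n + ∑ j ∈ Sᶜ, Real.log (U j) - Sᶜ.card * Real.log a := by
    rw [← Finset.sum_add_sum_compl S, Finset.sum_congr rfl fun j hj => if_pos hj,
      Finset.sum_congr (s₁ := Sᶜ) rfl fun j hj => if_neg (Finset.mem_compl.mp hj), hSsum]
    simp only [hlogv, Finset.sum_add_distrib, Finset.sum_sub_distrib, Finset.sum_const,
      nsmul_eq_mul]
    ring
  rw [Finset.sum_sub_distrib, Finset.sum_add_distrib, h.sum_min_price, hsplit,
    ← Finset.sum_filter] at htangent
  simp only [Finset.sum_sub_distrib, Finset.sum_const, Finset.card_univ, Fintype.card_fin,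
    nsmul_eq_mul] at hlower
  have hp1 : ∀ j ∈ Finset.univ.filter (fun j => 1 ≤ p j), p j ≠ 0 := fun j _ =>
    (h.price_pos j).ne'
  have hP1 : 0 < ∏ j ∈ Finset.univ.filter (fun j => 1 ≤ p j), p j :=
    Finset.prod_pos fun j _ => h.price_pos j
  have hP2 : 0 < ∏ i, bangPerBuck u p i := Finset.prod_pos fun i _ => hB i
  have hQ1 : 0 < ∏ j ∈ Sᶜ, U j := Finset.prod_pos fun j _ => hU j
  have hQ2 : 0 < a ^ (n - Sᶜ.card) := pow_pos ha _
  have hQ3 : 0 < ∏ i, α i := Finset.prod_pos fun i _ => hα i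
  refine Real.rpow_le_rpow (mul_pos hP1 hP2).le ?_ (by positivity)
  rw [← Real.log_le_log_iff (mul_pos hP1 hP2) (mul_pos (mul_pos hQ1 hQ2) hQ3),
    Real.log_mul hP1.ne' hP2.ne', Real.log_mul (mul_pos hQ1 hQ2).ne' hQ3.ne',
    Real.log_mul hQ1.ne' hQ2.ne', Real.log_pow, Real.log_prod hp1,
    Real.log_prod fun i _ => (hB i).ne', Real.log_prod fun j _ => (hU j).ne',
    Real.log_prod fun i _ => (hα i).ne', Nat.cast_sub hK.le]
  linarith

/-! ### CG is attained -/

theorem IsSpendingRestrictedSolution.uniformUtility_bangPerBuck {n m : ℕ}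
    {u x : Fin n → Fin m → ℝ} {p : Fin m → ℝ} (h : IsSpendingRestrictedSolution u x p)
    (hn : 0 < n) {g : Fin n → Fin m} (hgu : ∀ i, 0 < u i (g i)) {c : ℝ} (hc : 0 < c)
    (j : Fin m) : uniformUtility u (fun i => c * bangPerBuck u p i) j = p j / c := by
  have : Nonempty (Fin n) := ⟨⟨0, hn⟩⟩
  have hB := h.bangPerBuck_pos hgu
  apply le_antisymm
  · refine ciSup_le fun i => ?_
    have := le_bangPerBuck u p i j
    rw [div_le_iff₀ (h.price_pos j)] at this
    rw [div_le_div_iff₀ (mul_pos hc (hB i)) hc]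
    nlinarith
  · obtain ⟨i, hi⟩ := h.exists_pos_alloc j
    refine le_trans (le_of_eq ?_) (le_uniformUtility u _ i j)
    have := h.max_bang_per_buck i j hi
    rw [div_eq_iff (h.price_pos j).ne'] at this
    rw [this, mul_comm c, mul_div_mul_left _ _ (hB i).ne']

/-- For `α = c * bangPerBuck`, `hsum` makes the average `1`. The factor `c ^ n` from `∏ α` loses `c
^ Sᶜ.card` to the uniform utilities, which leaves the left side of `hprod`. -/
theorem IsSpendingRestrictedSolution.cgBound_mem_bmvValues_of_threshold {n m : ℕ}
    {u x : Fin n → Fin m → ℝ} {p : Fin m → ℝ} (h : IsSpendingRestrictedSolution u x p)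
    (hn : 0 < n) {g : Fin n → Fin m} (hgu : ∀ i, 0 < u i (g i)) {c : ℝ} (hc : 0 < c)
    {S : Finset (Fin m)} (hS : S.Nonempty) (hSc : ∀ j, j ∉ S → c < p j)
    (hsum : ∑ j ∈ S, p j = c * (n - Sᶜ.card))
    (hprod : c ^ (n - Sᶜ.card) * ∏ j ∈ Sᶜ, p j =
      ∏ j ∈ Finset.univ.filter (fun j => 1 ≤ p j), p j) :
    cgBound u p ∈ bmvValues u := by
  have hB := h.bangPerBuck_pos hgu
  have hU := h.uniformUtility_bangPerBuck hn hgu hc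
  have hpos : (0 : ℝ) < n - Sᶜ.card := by
    have := Finset.sum_pos (fun j _ => h.price_pos j) hS
    rw [hsum] at this
    exact (mul_pos_iff_of_pos_left hc).mp this
  have hK : Sᶜ.card < n := by
    have : (Sᶜ.card : ℝ) < n := by linarith
    exact_mod_cast this
  have havg : average u (fun i => c * bangPerBuck u p i) S = 1 := by
    simp only [average, hU, cast_sub_card_compl]
    rw [← Finset.sum_div, hsum, mul_div_cancel_left₀ _ hc.ne', div_self hpos.ne']
  refine ⟨fun i => c * bangPerBuck u p i, fun i => mul_pos hc (hB i), S, ⟨?_, ?_⟩, ?_⟩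
  · have h := S.card_add_card_compl
    rw [Fintype.card_fin] at h
    omega
  · intro j hj
    rw [havg, hU, one_lt_div hc]
    exact hSc j hj
  · simp only [cgBound, bmvObjective, havg, hU, one_pow, mul_one]
    congr 1
    rw [← hprod, Finset.prod_mul_distrib, Finset.prod_div_distrib, Finset.prod_const,
      Finset.prod_const, Finset.card_univ, Fintype.card_fin,
      ← pow_sub_mul_pow c hK.le]
    have := (pow_pos hc Sᶜ.card).ne'
    field_simp

theorem IsSpendingRestrictedSolution.cgBound_mem_bmvValues {n m : ℕ}
    {u x : Fin n → Fin m → ℝ} {p : Fin m → ℝ} (h : IsSpendingRestrictedSolution u x p)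
    (hn : 0 < n) {g : Fin n → Fin m} (hgu : ∀ i, 0 < u i (g i)) :
    cgBound u p ∈ bmvValues u := by
  classical
  have htotal := h.sum_min_price
  by_cases hex : ∃ j, p j ≤ 1
  · obtain ⟨j₀, hj₀⟩ := hex
    refine h.cgBound_mem_bmvValues_of_threshold hn hgu one_pos
      (S := Finset.univ.filter fun j => p j ≤ 1) ⟨j₀, by simp [hj₀]⟩ (by simp) ?_ ?_
    · rw [← Finset.sum_add_sum_compl (Finset.univ.filter fun j => p j ≤ 1),
        Finset.sum_congr rfl fun j hj => min_eq_left (Finset.mem_filter.mp hj).2,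
        Finset.sum_congr (s₁ := (Finset.univ.filter fun j => p j ≤ 1)ᶜ) (g := fun _ => 1) rfl
          fun j hj => min_eq_right (by simpa using hj : 1 < p j).le] at htotal
      simp only [Finset.sum_const, nsmul_eq_mul, mul_one] at htotal
      linarith
    · rw [one_pow, one_mul]
      -- Goods of price exactly `1` lie in `S` but contribute a factor `1`.
      refine Finset.prod_subset (fun j hj => ?_) fun j hj hj' => ?_
      · simpa using (by simpa using hj : 1 < p j).le
      · exact le_antisymm (by simpa using hj') (by simpa using hj)
  -- With all prices above `1`, threshold `1` would make `S` empty, which is inadmissible. Total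
  -- spending forces `m = n`, and the least price serves as threshold.
  · push Not at hex
    have hmn : m = n := by
      rw [Finset.sum_congr rfl fun j _ => min_eq_right (hex j).le] at htotal
      simpa using htotal
    subst hmn
    obtain ⟨j₀, -, hj₀⟩ := Finset.exists_min_image Finset.univ p ⟨⟨0, hn⟩, Finset.mem_univ _⟩
    set S := Finset.univ.filter fun j => p j = p j₀ with hS
    have hpS : ∀ j ∈ S, p j = p j₀ := fun j hj => (Finset.mem_filter.mp hj).2
    have hcard : S.card + Sᶜ.card = m := by
      simp [Finset.card_add_card_compl]
    refine h.cgBound_mem_bmvValues_of_threshold hn hgu (h.price_pos j₀) (S := S)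
      ⟨j₀, by simp [hS]⟩ (fun j hj => ?_) ?_ ?_
    · exact lt_of_le_of_ne (hj₀ j (Finset.mem_univ _)) fun he => hj (by simp [hS, he])
    · rw [Finset.sum_congr rfl hpS, Finset.sum_const, nsmul_eq_mul]
      have : (S.card : ℝ) + Sᶜ.card = m := by exact_mod_cast hcard
      rw [← this]
      ring
    · have hall : (Finset.univ.filter fun j => 1 ≤ p j) = Finset.univ := by
        simp [fun j => (hex j).le]
      rw [hall, ← Finset.prod_mul_prod_compl S, Finset.prod_congr rfl hpS, Finset.prod_const]
      congr 2
      omega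

end NashWelfare

theorem mainTheorem6 (n m : ℕ) (hn : 0 < n) (u : Fin n → Fin m → ℝ)
    (hu : ∀ i j, 0 ≤ u i j)
    (hgood : ∀ j, ∃ i, 0 < u i j)
    (hpos : ∃ A : Fin m → Fin n, 0 < NashWelfare.nashSocialWelfare u A) :
    (∃ x p, NashWelfare.IsSpendingRestrictedSolution u x p) ∧
    IsLeast (NashWelfare.bmvValues u) (NashWelfare.bmvBound u) ∧
    ∀ x p, NashWelfare.IsSpendingRestrictedSolution u x p →
      NashWelfare.cgBound u p = NashWelfare.bmvBound u := by
  obtain ⟨A, hA⟩ := hpos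
  obtain ⟨g, hg, hgu⟩ := NashWelfare.exists_injective_pos_utility hn hu hA
  have hnm : n ≤ m := by simpa using Fintype.card_le_of_injective g hg
  have hleast : ∀ x p, NashWelfare.IsSpendingRestrictedSolution u x p →
      IsLeast (NashWelfare.bmvValues u) (NashWelfare.cgBound u p) := by
    intro x p h
    refine ⟨h.cgBound_mem_bmvValues hn hgu, ?_⟩
    rintro v ⟨α, hα, S, hS, rfl⟩
    exact h.cgBound_le_bmvObjective hnm hgood hgu hα hS
  have hex := NashWelfare.exists_isSpendingRestrictedSolution hu hgood hg hgu
  refine ⟨hex, ?_, fun x p h => (hleast x p h).csInf_eq.symm⟩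
  obtain ⟨x, p, h⟩ := hex
  rw [NashWelfare.bmvBound, (hleast x p h).csInf_eq]
  exact hleast x p h
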